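/- Let $\mathbb K=\mathbb R$ or $\mathbb K=\mathbb C$, let $U\subseteq\mathbb K^n$ be nonempty, open and connected, let $f:U\to\mathbb K^n$ be analytic, and let $\emptyset\neq U^*\subseteq U$ be open. Consider the differential equation $\dot x=f(x)$ with real time $t$; solutions are defined on open intervals. A set $Y\subseteq U^*$ is called invariant for $\dot x=f(x)$ on $U^*$ if every solution $z:I\to U^*$ of $\dot x=f(x)$ on an open interval $I\ni 0$ with $z(0)\in Y$ satisfies $z(t)\in Y$ for all $t\in I$. A symmetry $\Phi:U^*\to U$ of $\dot x=f(x)$ is a map that sends every solution of $\dot x=f(x)$ in $U^*$ to a solution of $\dot x=f(x)$ in $U$, and that has an invertible derivative $D\Phi(x)$ at every $x\in U^*$. For analytic $h:U^*\to\mathbb K^n$ put $[h,f](x)=Df(x)h(x)-Dh(x)f(x)$ for $x\in U^*$. (a) If $\Phi:U^*\to U$ is a symmetry of $\dot x=f(x)$, then its fixed point set $\{y\in U^*:\Phi(y)=y\}$ is invariant for $\dot x=f(x)$ on $U^*$. (b) If $h:U^*\to\mathbb K^n$ is analytic and $[h,f]=0$ on $U^*$, then the set $\{y\in U^*:h(y)=0\}$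 of stationary points of $h$ is invariant for $\dot x=f(x)$ on $U^*$. (c) If $h_1,\ldots,h_r:U^*\to\mathbb K^n$ are analytic and $[h_i,f]=0$ on $U^*$ for all $i$, then for every integer $s$ with $0\le s\le r$ the set $$Z_s=\{y\in U^*:\ \operatorname{rank}(h_1(y),\ldots,h_r(y))\le s\}$$ is invariant for $\dot x=f(x)$ on $U^*$. -/

import Mathlib

/-- `γ` is a solution in `U`, on the open interval `I` of real times, of the autonomous
differential equation `ẋ = f(x)` in `𝕜ⁿ`. -/
def IsSolution {𝕜 : Type*} [RCLike 𝕜] {n : ℕ} (f : (Fin n → 𝕜) → (Fin n → 𝕜))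
    (U : Set (Fin n → 𝕜)) (I : Set ℝ) (γ : ℝ → (Fin n → 𝕜)) : Prop :=
  IsOpen I ∧ I.OrdConnected ∧ ∀ t ∈ I, γ t ∈ U ∧ HasDerivAt γ (f (γ t)) t

/-- `Y` is an invariant set of the equation `ẋ = f(x)` considered on the open set `U`: every
solution in `U` which starts in `Y` at time `0` stays in `Y`, for all positive and negative times
in its interval of existence. -/
def IsInvariantSet {𝕜 : Type*} [RCLike 𝕜] {n : ℕ} (f : (Fin n → 𝕜) → (Fin n → 𝕜))
    (U Y : Set (Fin n → 𝕜)) : Prop :=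
  Y ⊆ U ∧ ∀ (I : Set ℝ) (γ : ℝ → (Fin n → 𝕜)), IsSolution f U I γ → (0 : ℝ) ∈ I → γ 0 ∈ Y →
    ∀ t ∈ I, γ t ∈ Y

/-- `Φ : W → V` maps every solution of `ẋ = f(x)` in `W` to a solution of `ẋ = g(x)` in `V`. -/
def IsSolutionPreserving {𝕜 : Type*} [RCLike 𝕜] {n m : ℕ}
    (f : (Fin n → 𝕜) → (Fin n → 𝕜)) (W : Set (Fin n → 𝕜))
    (g : (Fin m → 𝕜) → (Fin m → 𝕜)) (V : Set (Fin m → 𝕜))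
    (Φ : (Fin n → 𝕜) → (Fin m → 𝕜)) : Prop :=
  Set.MapsTo Φ W V ∧ ∀ (I : Set ℝ) (γ : ℝ → (Fin n → 𝕜)), IsSolution f W I γ →
    IsSolution g V I (fun t => Φ (γ t))

/-- `Φ : W → U` is a symmetry of the equation `ẋ = f(x)` on `U`: it is solution-preserving from
this equation to itself, and its derivative exists and is invertible at each point of `W`. -/
def IsSymmetry {𝕜 : Type*} [RCLike 𝕜] {n : ℕ} (f : (Fin n → 𝕜) → (Fin n → 𝕜))
    (U W : Set (Fin n → 𝕜)) (Φ : (Fin n → 𝕜) → (Fin n → 𝕜)) : Prop :=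
  IsSolutionPreserving f W f U Φ ∧
    ∀ x ∈ W, ∃ e : (Fin n → 𝕜) ≃L[𝕜] (Fin n → 𝕜),
      HasFDerivAt Φ (e : (Fin n → 𝕜) →L[𝕜] (Fin n → 𝕜)) x

open Filter Topology Set

/-! Everything reduces to one principle: a curve with `‖x'‖ ≤ K ‖x‖` near each of its zeros vanishes
identically once it vanishes somewhere, by Grönwall and connectedness of the interval. For a
symmetry, `Φ ∘ γ` and `γ` solve the same equation and agree at time 0, so they coincide
(`IsSolution.eqOn`). If `[h, f] = 0`, then `x = h ∘ γ` solves the linear equation `x' = Df(γ) x`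
(`isInvariantSet_zeros`). For ranks, every constant combination of the `h i` also commutes with `f`,
so a linear relation among them at `γ 0` persists along `γ`; the kernel cannot shrink, hence the
rank cannot grow. -/

/-- A differential inequality `‖x'‖ ≤ K ‖x‖` near a zero of `x` forces `x` to vanish nearby. -/
theorem eventually_eq_zero_of_norm_deriv_le {E : Type*} [NormedAddCommGroup E] [NormedSpace ℝ E]
    {x x' : ℝ → E} {t₀ K : ℝ} (h₀ : x t₀ = 0)
    (hx : ∀ᶠ t in 𝓝 t₀, HasDerivAt x (x' t) t ∧ ‖x' t‖ ≤ K * ‖x t‖) :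
    ∀ᶠ t in 𝓝 t₀, x t = 0 := by
  obtain ⟨ε, hε, hball⟩ := Metric.eventually_nhds_iff.1 hx
  refine Metric.eventually_nhds_iff.2 ⟨ε, hε, fun t ht => ?_⟩
  rw [Real.dist_eq, abs_lt] at ht
  have hd : ∀ s, |s - t₀| < ε → HasDerivAt x (x' s) s ∧ ‖x' s‖ ≤ K * ‖x s‖ :=
    fun s hs => hball (by rwa [Real.dist_eq])
  rcases le_total t₀ t with h | h
  · have hI : ∀ s ∈ Icc t₀ t, |s - t₀| < ε := fun s hs =>
      abs_lt.2 ⟨by linarith [hs.1], by linarith [hs.2]⟩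
    exact eq_zero_of_abs_deriv_le_mul_abs_self_of_eq_zero_right (f' := x') (K := K)
      (fun s hs => (hd s (hI s hs)).1.continuousAt.continuousWithinAt)
      (fun s hs => (hd s (hI s (Ico_subset_Icc_self hs))).1.hasDerivWithinAt) h₀
      (fun s hs => (hd s (hI s (Ico_subset_Icc_self hs))).2) t ⟨h, le_rfl⟩
  -- Grönwall's estimate runs forward in time, so earlier times are reached by reversing time.
  · have hI : ∀ s ∈ Icc (-t₀) (-t), |-s - t₀| < ε := fun s hs =>
      abs_lt.2 ⟨by linarith [hs.2], by linarith [hs.1]⟩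
    have hneg : ∀ s ∈ Icc (-t₀) (-t), HasDerivAt (fun s => x (-s)) (-x' (-s)) s := fun s hs => by
      simpa [Function.comp_def] using (hd (-s) (hI s hs)).1.scomp s (hasDerivAt_neg s)
    have := eq_zero_of_abs_deriv_le_mul_abs_self_of_eq_zero_right (f := fun s => x (-s))
      (f' := fun s => -x' (-s)) (K := K) (a := -t₀) (b := -t)
      (fun s hs => (hneg s hs).continuousAt.continuousWithinAt)
      (fun s hs => (hneg s (Ico_subset_Icc_self hs)).hasDerivWithinAt) (by simpa using h₀)
      (fun s hs => by simpa using (hd (-s) (hI s (Ico_subset_Icc_self hs))).2) (-t)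
      ⟨by linarith, le_rfl⟩
    simpa using this

/-- If near each of its zeros on an open interval `I` the function `x` satisfies a differential
inequality `‖x'‖ ≤ K ‖x‖`, and `x` has a zero on `I`, then `x` vanishes on `I`. -/
theorem eqOn_zero_of_norm_deriv_le {E : Type*} [NormedAddCommGroup E] [NormedSpace ℝ E]
    {x x' : ℝ → E} {I : Set ℝ} (hIo : IsOpen I) (hI : I.OrdConnected)
    (hx : ∀ t ∈ I, HasDerivAt x (x' t) t)
    (hK : ∀ t₀ ∈ I, x t₀ = 0 → ∃ K : ℝ, ∀ᶠ t in 𝓝 t₀, ‖x' t‖ ≤ K * ‖x t‖)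
    {a : ℝ} (ha : a ∈ I) (hxa : x a = 0) : ∀ t ∈ I, x t = 0 := by
  have hloc : ∀ t₀ ∈ I, x t₀ = 0 → ∀ᶠ t in 𝓝 t₀, x t = 0 := fun t₀ ht₀ h₀ => by
    obtain ⟨K, hK⟩ := hK t₀ ht₀ h₀
    refine eventually_eq_zero_of_norm_deriv_le (x' := x') (K := K) h₀ ?_
    filter_upwards [hK, hIo.mem_nhds ht₀] with t h1 h2 using ⟨hx t h2, h1⟩
  have hcont : ContinuousOn x I := fun t ht => (hx t ht).continuousAt.continuousWithinAt
  -- The preconnected `I` is covered by two disjoint open sets: the interior of the zero set, which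
  -- contains `a`, and the points of `I` where `x ≠ 0`.
  have hsub : I ⊆ {t | ∀ᶠ s in 𝓝 t, x s = 0} :=
    IsPreconnected.subset_left_of_subset_union (v := I ∩ x ⁻¹' {0}ᶜ)
      isOpen_setOfPred_eventually_nhds
      (hcont.isOpen_inter_preimage hIo isClosed_singleton.isOpen_compl)
      (disjoint_left.2 fun t ht h => h.2 (Eventually.self_of_nhds (p := fun s => x s = 0) ht))
      (fun t ht => (em (x t = 0)).imp (hloc t ht) fun h => ⟨ht, h⟩)
      ⟨a, ha, hloc a ha hxa⟩ hI.isPreconnected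
  exact fun t ht => (hsub ht).self_of_nhds

/-- Uniqueness of solutions of an autonomous equation with analytic right-hand side. -/
theorem IsSolution.eqOn {𝕜 : Type*} [RCLike 𝕜] {n : ℕ} {f : (Fin n → 𝕜) → (Fin n → 𝕜)}
    {U : Set (Fin n → 𝕜)} (hf : AnalyticOnNhd 𝕜 f U) {I : Set ℝ} {γ δ : ℝ → (Fin n → 𝕜)}
    (hγ : IsSolution f U I γ) (hδ : IsSolution f U I δ) {a : ℝ} (ha : a ∈ I) (h : γ a = δ a) :
    EqOn γ δ I := by
  refine fun t ht => sub_eq_zero.1 (eqOn_zero_of_norm_deriv_le (x := fun t => γ t - δ t)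
    (x' := fun t => f (γ t) - f (δ t)) hγ.1 hγ.2.1
    (fun t ht => (hγ.2.2 t ht).2.sub (hδ.2.2 t ht).2) (fun t₀ ht₀ h₀ => ?_) ha
    (sub_eq_zero.2 h) t ht)
  -- Where the solutions meet, `f` is locally Lipschitz; its constant serves as `K`.
  obtain ⟨K, s, hs, hL⟩ :=
    (hf _ (hγ.2.2 t₀ ht₀).1).hasStrictFDerivAt.exists_lipschitzOnWith
  have hsδ : s ∈ 𝓝 (δ t₀) := by rwa [← sub_eq_zero.1 h₀]
  refine ⟨K, ?_⟩
  filter_upwards [(hγ.2.2 t₀ ht₀).2.continuousAt hs, (hδ.2.2 t₀ ht₀).2.continuousAt hsδ]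
    with t h1 h2 using hL.norm_sub_le h1 h2

/-- The fixed point set of a solution-preserving map is invariant. -/
theorem isInvariantSet_fixedPoints {𝕜 : Type*} [RCLike 𝕜] {n : ℕ}
    {f : (Fin n → 𝕜) → (Fin n → 𝕜)} {U W : Set (Fin n → 𝕜)} (hf : AnalyticOnNhd 𝕜 f U)
    (hWU : W ⊆ U) {Φ : (Fin n → 𝕜) → (Fin n → 𝕜)} (hΦ : IsSolutionPreserving f W f U Φ) :
    IsInvariantSet f W {y | y ∈ W ∧ Φ y = y} :=
  ⟨fun _ hy => hy.1, fun I γ hγ h0 hγ0 t ht => ⟨(hγ.2.2 t ht).1,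
    (hΦ.2 I γ hγ).eqOn hf ⟨hγ.1, hγ.2.1, fun s hs => (hγ.2.2 s hs).imp_left (@hWU _)⟩
      h0 hγ0.2 ht⟩⟩

/-- The zero set of a vector field commuting with `f` is invariant for `ẋ = f(x)`. -/
theorem isInvariantSet_zeros {𝕜 : Type*} [RCLike 𝕜] {n : ℕ}
    {f : (Fin n → 𝕜) → (Fin n → 𝕜)} {W : Set (Fin n → 𝕜)} (hf : AnalyticOnNhd 𝕜 f W)
    {h : (Fin n → 𝕜) → (Fin n → 𝕜)} (hh : DifferentiableOn 𝕜 h W) (hW : IsOpen W)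
    (hb : ∀ x ∈ W, VectorField.lieBracket 𝕜 h f x = 0) :
    IsInvariantSet f W {y | y ∈ W ∧ h y = 0} := by
  refine ⟨fun _ hy => hy.1, fun I γ hγ h0 hγ0 t ht => ⟨(hγ.2.2 t ht).1, ?_⟩⟩
  refine eqOn_zero_of_norm_deriv_le (x := fun t => h (γ t))
    (x' := fun t => fderiv 𝕜 f (γ t) (h (γ t))) hγ.1 hγ.2.1 (fun t ht => ?_)
    (fun t₀ ht₀ _ => ?_) h0 hγ0.2 t ht
  · obtain ⟨hmem, hder⟩ := hγ.2.2 t ht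
    have hd := (hh.differentiableAt (hW.mem_nhds hmem)).hasFDerivAt
    -- The vanishing bracket turns `Df(γ) h(γ)` into `Dh(γ) f(γ)`, the chain rule derivative of `h ∘
    -- γ`.
    rw [sub_eq_zero.1 (hb _ hmem)]
    exact (hd.restrictScalars ℝ).comp_hasDerivAt t hder
  · obtain ⟨hmem, hder⟩ := hγ.2.2 t₀ ht₀
    have hc : ContinuousAt (fun t => ‖fderiv 𝕜 f (γ t)‖) t₀ :=
      ((hf _ hmem).fderiv.continuousAt.comp (f := γ) hder.continuousAt).norm
    -- The added 1 leaves room for `‖Df(γ t)‖` to vary near `t₀`.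
    refine ⟨‖fderiv 𝕜 f (γ t₀)‖ + 1, ?_⟩
    filter_upwards [hc.eventually_le_const (lt_add_one _)] with t ht
    exact (ContinuousLinearMap.le_opNorm _ _).trans
      (mul_le_mul_of_nonneg_right ht (norm_nonneg _))

/-- A linear combination of vector fields commuting with `f` commutes with `f`. -/
theorem lieBracket_sum_smul_eq_zero {𝕜 E ι : Type*} [NontriviallyNormedField 𝕜]
    [NormedAddCommGroup E] [NormedSpace 𝕜 E] [Fintype ι] {f : E → E} {h : ι → E → E} {x : E}
    (hh : ∀ i, DifferentiableAt 𝕜 (h i) x)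
    (hb : ∀ i, VectorField.lieBracket 𝕜 (h i) f x = 0) (c : ι → 𝕜) :
    VectorField.lieBracket 𝕜 (fun y => ∑ i, c i • h i y) f x = 0 := by
  have hd : fderiv 𝕜 (fun y => ∑ i, c i • h i y) x = ∑ i, c i • fderiv 𝕜 (h i) x :=
    (HasFDerivAt.fun_sum fun i _ => (hh i).hasFDerivAt.const_smul (c i)).fderiv
  simp only [VectorField.lieBracket, hd, map_sum, map_smul, sum_apply,
    smul_apply] at hb ⊢
  rw [← Finset.sum_sub_distrib]
  exact Finset.sum_eq_zero fun i _ => by rw [← smul_sub, hb i, smul_zero]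

/-- A matrix whose kernel contains that of another one has at most the rank of the latter. -/
theorem Matrix.rank_le_rank_of_mulVec_eq_zero {K m m' n : Type*} [Field K] [Fintype n]
    [Fintype m] [Fintype m'] {A : Matrix m n K} {B : Matrix m' n K}
    (h : ∀ c : n → K, A.mulVec c = 0 → B.mulVec c = 0) : B.rank ≤ A.rank := by
  have hle : LinearMap.ker A.mulVecLin ≤ LinearMap.ker B.mulVecLin := fun c hc => h c hc
  have h1 := A.mulVecLin.finrank_range_add_finrank_ker
  have h2 := B.mulVecLin.finrank_range_add_finrank_ker
  have h3 := Submodule.finrank_mono hle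
  simp only [Matrix.rank]
  omega

theorem theorem3p7 {𝕜 : Type*} [RCLike 𝕜] {n : ℕ}
    (U : Set (Fin n → 𝕜)) (hU : IsOpen U) (hUc : IsConnected U)
    (f : (Fin n → 𝕜) → (Fin n → 𝕜)) (hf : AnalyticOnNhd 𝕜 f U)
    (W : Set (Fin n → 𝕜)) (hW : IsOpen W) (hWne : W.Nonempty) (hWU : W ⊆ U) :
    (∀ Φ : (Fin n → 𝕜) → (Fin n → 𝕜), IsSymmetry f U W Φ →
      IsInvariantSet f W {y | y ∈ W ∧ Φ y = y}) ∧
    (∀ h : (Fin n → 𝕜) → (Fin n → 𝕜), AnalyticOnNhd 𝕜 h W →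
      (∀ x ∈ W, VectorField.lieBracket 𝕜 h f x = 0) →
      IsInvariantSet f W {y | y ∈ W ∧ h y = 0}) ∧
    (∀ (r : ℕ) (h : Fin r → (Fin n → 𝕜) → (Fin n → 𝕜)),
      (∀ i, AnalyticOnNhd 𝕜 (h i) W) →
      (∀ i, ∀ x ∈ W, VectorField.lieBracket 𝕜 (h i) f x = 0) →
      ∀ s : ℕ, s ≤ r →
        IsInvariantSet f W
          {y | y ∈ W ∧ (Matrix.of fun (k : Fin n) (i : Fin r) => h i y k).rank ≤ s}) := by
  have hfW := hf.mono hWU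
  refine ⟨fun Φ hΦ => isInvariantSet_fixedPoints hf hWU hΦ.1,
    fun h hh hb => isInvariantSet_zeros hfW hh.differentiableOn hW hb,
    fun r h hh hb s _ => ⟨fun _ hy => hy.1, fun I γ hγ h0 hγ0 t ht => ⟨(hγ.2.2 t ht).1,
      (Matrix.rank_le_rank_of_mulVec_eq_zero fun c hc => ?_).trans hγ0.2⟩⟩⟩
  -- Here `c` is a fixed kernel vector of the matrix at `γ 0`; it must be shown to lie in the kernel
  -- at `γ t`.
  have hmul : ∀ y, (Matrix.of fun (k : Fin n) (i : Fin r) => h i y k).mulVec c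
      = ∑ i, c i • h i y := fun y => by
    ext k
    simp [Matrix.mulVec, dotProduct, mul_comm]
  rw [hmul] at hc ⊢
  have hinv := isInvariantSet_zeros hfW (h := fun y => ∑ i, c i • h i y)
    (DifferentiableOn.fun_sum fun i _ => (hh i).differentiableOn.const_smul (c i)) hW
    fun x hx => lieBracket_sum_smul_eq_zero (fun i => (hh i x hx).differentiableAt)
      (fun i => hb i x hx) c
  exact (hinv.2 I γ hγ h0 ⟨hγ0.1, hc⟩ t ht).2
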